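/- Let $\mathcal X$ be a set of datasets with a symmetric neighboring relation $\sim$ for which there are two distinct neighboring datasets. A mechanism $M$ is a randomized map from $\mathcal X$ to some measurable outcome space $\mathcal Y$ (which may depend on $M$). - $M$ is $(\varepsilon,\delta)$-DP if $\Pr[M(x)\in S]\le e^{\varepsilon}\Pr[M(x')\in S]+\delta$ for all $x\sim x'$ and all measurable $S\subseteq\mathcal Y$, and $\varepsilon$-DP if it is $(\varepsilon,0)$-DP. - $M$ is $\varepsilon$-bounded range ($\varepsilon$-BR) if $$\Pr[M(x)\in S_1]\,\Pr[M(x')\in S_2]\le e^{\varepsilon}\,\Pr[M(x)\in S_2]\,\Pr[M(x')\in S_1]$$ for all $x\sim x'$ and all measurable $S_1,S_2\subseteq\mathcal Y$. (For discrete outcomes this says $\frac{\Pr[M(x)=y_1]}{\Pr[M(x')=y_1]}\le e^{\varepsilon}\frac{\Pr[M(x)=y_2]}{\Pr[M(x')=y_2]}$ for all outcomes $y_1,y_2$.) Let $\mathrm{DP}$ and $\mathrm{BR}$ denote the classes of all $\varepsilon$-DP and of all $\varepsilon$-BR mechanisms, with the same $\varepsilon$. For classes $\mathcal M_1,\mathcal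 M_2,\mathcal M_3$ let $(\mathcal M_1,\mathcal M_2,\mathcal M_3)$ be the class of their adaptive compositions: on input $x$ first $y_1\sim M_1(x)$ is drawn, then $y_2\sim M_2(x,y_1)$, then $y_3\sim M_3(x,y_1,y_2)$, and $(y_1,y_2,y_3)$ is released, where $M_1\in\mathcal M_1$, $M_2(\cdot,y_1)\in\mathcal M_2$ for every $y_1$, $M_3(\cdot,y_1,y_2)\in\mathcal M_3$ for every $(y_1,y_2)$, and $M_2$, $M_3$ depend measurably on the previous outcomes. For a mechanism $M$ and a class $\mathcal M$ put $$\delta_{\mathrm{opt}}(M;\varepsilon_g)=\inf\{\delta\ge 0: M\text{ is }(\varepsilon_g,\delta)\text{-DP}\},\qquad \delta_{\mathrm{opt}}(\mathcal M;\varepsilon_g)=\sup_{M\in\mathcal M}\delta_{\mathrm{opt}}(M;\varepsilon_g).$$ Let $0\le\varepsilon_g<\varepsilon$, let $q_{\varepsilon,t}=\dfrac{1-e^{t-\varepsilon}}{1-e^{-\varepsilon}}$ (the same formula with $2\varepsilon$ in place of $\varepsilon$ gives $q_{2\varepsilon,\varepsilon}$), and define $$x(t)=q_{2\varepsilon,\varepsilon}\left(q_{\varepsilon,t}\,q_{\varepsilon,\frac{\varepsilon_g-t}{2}}^2(1-e^{-\varepsilon})+(1-q_{\varepsilon,t})\,q_{\varepsilon,\frac{\varepsilon_g+\varepsilon-t}{2}}^2(1-e^{-\varepsilon})\right),$$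 $$y(t)=q_{2\varepsilon,\varepsilon}\left(q_{\varepsilon,t}(1-e^{\varepsilon_g-\varepsilon-t})+(1-q_{\varepsilon,t})\,q_{\varepsilon,\frac{\varepsilon_g+\varepsilon-t}{2}}^2(1-e^{-\varepsilon})\right),$$ $$z(t)=(1-q_{2\varepsilon,\varepsilon})\,q_{\varepsilon,t}\,q_{\varepsilon,\varepsilon+\frac{\varepsilon_g-t}{2}}^2(1-e^{-\varepsilon}).$$ Then $$\delta_{\mathrm{opt}}(\mathrm{DP},\mathrm{BR},\mathrm{BR};\varepsilon_g)>\delta_{\mathrm{opt}}(\mathrm{BR},\mathrm{DP},\mathrm{BR};\varepsilon_g),$$ and moreover $$\delta_{\mathrm{opt}}(\mathrm{DP},\mathrm{BR},\mathrm{BR};\varepsilon_g)=\begin{cases}x(\varepsilon/2)+z\left(\frac{2\varepsilon+\varepsilon_g}{3}\right)&\text{if }\varepsilon_g\ge\varepsilon/2,\\ y\left(\frac{\varepsilon+\varepsilon_g}{3}\right)+z\left(\frac{2\varepsilon+\varepsilon_g}{3}\right)&\text{if }\varepsilon_g<\varepsilon/2,\end{cases}$$ $$\delta_{\mathrm{opt}}(\mathrm{BR},\mathrm{DP},\mathrm{BR};\varepsilon_g)=\begin{cases}\max\{x(\varepsilon/2),\,y(\varepsilon_g)+z(\varepsilon_g)\}&\text{if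 }\varepsilon_g\ge\varepsilon/2,\\ \max\{x(\varepsilon_g),\,y(\varepsilon/2)+z(\varepsilon/2)\}&\text{if }\varepsilon_g<\varepsilon/2.\end{cases}$$ -/

import Mathlib

open MeasureTheory ProbabilityTheory

universe u v

noncomputable section

/-- A randomized algorithm with inputs in `X`: a measurable outcome space `Out` and, for every
input `x`, the law `law x` of the outcome on input `x`. -/
structure Mechanism (X : Type v) where
  Out : Type u
  [measurableSpace : MeasurableSpace Out]
  law : X → Measure Out
  [isProbabilityMeasure : ∀ x, IsProbabilityMeasure (law x)]

attribute [instance] Mechanism.measurableSpace Mechanism.isProbabilityMeasure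

/-- `M` is `(ε, δ)`-differentially private for the neighboring relation `Nbr`. -/
def IsDP {X : Type v} (Nbr : X → X → Prop) (M : Mechanism.{u, v} X) (ε δ : ℝ) : Prop :=
  ∀ x x', Nbr x x' → ∀ S : Set M.Out, MeasurableSet S →
    (M.law x).real S ≤ Real.exp ε * (M.law x').real S + δ

/-- `M` is `ε`-bounded range for the neighboring relation `Nbr`. The inequality
`P(y₁) / P'(y₁) ≤ e ^ ε * (P(y₂) / P'(y₂))` between likelihood ratios is written with cleared
denominators and on events, so that it makes sense for outcome spaces that are not discrete; on a
discrete outcome space it is the same as the inequality for all pairs of single outcomes. -/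
def IsBR {X : Type v} (Nbr : X → X → Prop) (M : Mechanism.{u, v} X) (ε : ℝ) : Prop :=
  ∀ x x', Nbr x x' → ∀ S₁ S₂ : Set M.Out, MeasurableSet S₁ → MeasurableSet S₂ →
    (M.law x).real S₁ * (M.law x').real S₂ ≤
      Real.exp ε * ((M.law x).real S₂ * (M.law x').real S₁)

/-- The class of all `ε`-DP mechanisms. -/
def classDP {X : Type v} (Nbr : X → X → Prop) (ε : ℝ) : Set (Mechanism.{u, v} X) :=
  {M | IsDP Nbr M ε 0}

/-- The class of all `ε`-BR mechanisms. -/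
def classBR {X : Type v} (Nbr : X → X → Prop) (ε : ℝ) : Set (Mechanism.{u, v} X) :=
  {M | IsBR Nbr M ε}

/-- The second mechanism of an adaptive composition: a mechanism for every
outcome `y : Y` seen before, depending measurably on `y`. -/
structure AdaptiveMechanism (X : Type v) (Y : Type u) [MeasurableSpace Y] where
  Out : Type u
  [measurableSpace : MeasurableSpace Out]
  law : X → Kernel Y Out
  [isMarkovKernel : ∀ x, IsMarkovKernel (law x)]

attribute [instance] AdaptiveMechanism.measurableSpace AdaptiveMechanism.isMarkovKernel

/-- The mechanism `M₂(·, y)` that is run once the outcome `y` has been seen. -/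
def AdaptiveMechanism.given {X : Type v} {Y : Type u} [MeasurableSpace Y]
    (M₂ : AdaptiveMechanism.{u, v} X Y) (y : Y) : Mechanism.{u, v} X where
  Out := M₂.Out
  law := fun x => M₂.law x y

/-- The mechanism `x ↦ (M₁(x), M₂(x, M₁(x)))`, which releases both outcomes. -/
def Mechanism.andThen {X : Type v} (M₁ : Mechanism.{u, v} X)
    (M₂ : AdaptiveMechanism.{u, v} X M₁.Out) : Mechanism.{u, v} X where
  Out := M₁.Out × M₂.Out
  law := fun x => M₁.law x ⊗ₘ M₂.law x

/-- The class `(C₁, C₂)` of adaptively selected mechanisms: `M₁` is in `C₁`, and `M₂(·, y)` is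
in `C₂` for every outcome `y` of `M₁`. -/
def adaptive {X : Type v} (C₁ C₂ : Set (Mechanism.{u, v} X)) : Set (Mechanism.{u, v} X) :=
  {M | ∃ M₁ ∈ C₁, ∃ M₂ : AdaptiveMechanism.{u, v} X M₁.Out,
    (∀ y, M₂.given y ∈ C₂) ∧ M = M₁.andThen M₂}

/-- The class `(C₁, C₂, C₃)`: three adaptively selected mechanisms, in this order. -/
def adaptive₃ {X : Type v} (C₁ C₂ C₃ : Set (Mechanism.{u, v} X)) : Set (Mechanism.{u, v} X) :=
  adaptive (adaptive C₁ C₂) C₃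

/-- The optimal privacy parameter `δ_opt(M; εg)` of a mechanism. -/
def deltaOptMech {X : Type v} (Nbr : X → X → Prop) (M : Mechanism.{u, v} X) (εg : ℝ) : ℝ :=
  sInf {δ : ℝ | 0 ≤ δ ∧ IsDP Nbr M εg δ}

/-- The optimal privacy parameter `δ_opt(C; εg)` of a class of mechanisms. -/
def deltaOpt {X : Type v} (Nbr : X → X → Prop) (C : Set (Mechanism.{u, v} X)) (εg : ℝ) : ℝ :=
  sSup {d : ℝ | ∃ M ∈ C, d = deltaOptMech Nbr M εg}

/-- `q_{ε, t}`, the probability that generalized randomized response outputs 0 on input 0. -/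
def qRR (ε t : ℝ) : ℝ := (1 - Real.exp (t - ε)) / (1 - Real.exp (-ε))

/-- The function `x(t)`. -/
def xFun (ε εg t : ℝ) : ℝ :=
  qRR (2 * ε) ε *
    (qRR ε t * qRR ε ((εg - t) / 2) ^ 2 * (1 - Real.exp (-ε)) +
      (1 - qRR ε t) * qRR ε ((εg + ε - t) / 2) ^ 2 * (1 - Real.exp (-ε)))

/-- The function `y(t)`. -/
def yFun (ε εg t : ℝ) : ℝ :=
  qRR (2 * ε) ε *
    (qRR ε t * (1 - Real.exp (εg - ε - t)) +
      (1 - qRR ε t) * qRR ε ((εg + ε - t) / 2) ^ 2 * (1 - Real.exp (-ε)))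

/-- The function `z(t)`. -/
def zFun (ε εg t : ℝ) : ℝ :=
  (1 - qRR (2 * ε) ε) * qRR ε t * qRR ε (ε + (εg - t) / 2) ^ 2 * (1 - Real.exp (-ε))

end

/-! Maximizing P(S) - e^s Q(S) over events of a composition is a dynamic program in the threshold s.
On neighbors, an ε-BR mechanism has likelihood ratio in [e^(t-ε), e^t] for some t in [0, ε]
(`exists_ratioBounded`), and an ε-DP mechanism has it in [e^(-ε), e^ε]. A pair with ratio in
[e^(t-E), e^t] is dominated by generalized randomized response, whose two outcomes move s to s - t
and s + E - t (`RatioBounded.integral_sub_le`). Since randomized response is itself admissible,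
`deltaOpt_adaptive₃_le` and `le_deltaOpt_adaptive₃` reduce both values to the same kind of
optimization over parameters, with terminal value `brDelta`.

Let A(t) and B(t) be the contributions of the thresholds εg - ε and εg + ε left by the DP step, when
the BR step that shares the composition with it has parameter t. If DP comes first, t may depend on
its outcome, and the value is max A + max B. If BR comes first, one t serves both branches, and the
value is max (A + B).

At t = εg, A switches from x to y and B from 0 to z. Since y + z = x identically
(`yFun_add_zFun_eq_xFun`), A + B = x on all of [0, ε], with maximum x(ε/2); the `max` in the stated
formula always picks this value. The inequality is strict because B has its unique, positive maximum
at (2ε + εg)/3, not at ε/2. -/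

/-! ### Likelihood-ratio bounds and domination by generalized randomized response. -/

/-- The likelihood ratio of `P` with respect to `Q` lies between `exp (t - E)` and `exp t`. -/
structure RatioBounded {Y : Type*} [MeasurableSpace Y] (E t : ℝ) (P Q : Measure Y) : Prop where
  le : ∀ S, MeasurableSet S → P.real S ≤ Real.exp t * Q.real S
  ge : ∀ S, MeasurableSet S → Real.exp (t - E) * Q.real S ≤ P.real S

theorem qRR_mem_Icc {E t : ℝ} (hE : 0 < E) (h0 : 0 ≤ t) (h1 : t ≤ E) :
    qRR E t ∈ Set.Icc (0 : ℝ) 1 := by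
  have hD : 0 < 1 - Real.exp (-E) := by simpa using hE
  refine ⟨div_nonneg ?_ hD.le, (div_le_one hD).2 ?_⟩
  · simpa using h1
  · have : Real.exp (-E) ≤ Real.exp (t - E) := Real.exp_le_exp.2 (by linarith)
    linarith

/-- `qRR` is the probability of `true` that puts the likelihood ratio of the outcome `false` at
exactly e^(t-E), when that of `true` is e^t. -/
theorem one_sub_exp_neg_mul_qRR {E : ℝ} (hE : 0 < E) (t : ℝ) :
    1 - Real.exp (-t) * qRR E t = Real.exp (E - t) * (1 - qRR E t) := by
  have hD : 0 < 1 - Real.exp (-E) := by simpa using hE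
  have e1 : Real.exp (t - E) = Real.exp t * Real.exp (-E) := by rw [← Real.exp_add]; ring_nf
  have e2 : Real.exp (E - t) = (Real.exp (-E))⁻¹ * Real.exp (-t) := by
    rw [← Real.exp_neg, ← Real.exp_add]; ring_nf
  have e3 : Real.exp (-t) = (Real.exp t)⁻¹ := Real.exp_neg t
  have := Real.exp_pos t
  have := Real.exp_pos (-E)
  rw [qRR, e1, e2, e3]
  field_simp
  ring

/-- A law on two points giving mass `p`, truncated to `[0, 1]`, to `true`. -/
noncomputable def biasedCoin (p : ℝ) : Measure (ULift.{u} Bool) :=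
  ENNReal.ofReal (Set.projIcc (0 : ℝ) 1 zero_le_one p) • Measure.dirac ⟨true⟩ +
    ENNReal.ofReal (1 - Set.projIcc (0 : ℝ) 1 zero_le_one p) • Measure.dirac ⟨false⟩

instance (p : ℝ) : IsProbabilityMeasure (biasedCoin.{u} p) := by
  constructor
  have h := (Set.projIcc (0 : ℝ) 1 zero_le_one p).2
  simp only [biasedCoin, Measure.coe_add, Measure.coe_smul, Pi.add_apply, Pi.smul_apply,
    measure_univ, smul_eq_mul, mul_one]
  rw [← ENNReal.ofReal_add h.1 (by linarith [h.2])]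
  simp

theorem integral_biasedCoin {p : ℝ} (hp : p ∈ Set.Icc (0 : ℝ) 1) (g : ULift.{u} Bool → ℝ) :
    ∫ y, g y ∂(biasedCoin p) = p * g ⟨true⟩ + (1 - p) * g ⟨false⟩ := by
  rw [biasedCoin, Set.projIcc_of_mem _ hp, integral_add_measure
      ((integrable_dirac (by simp)).smul_measure ENNReal.ofReal_ne_top)
      ((integrable_dirac (by simp)).smul_measure ENNReal.ofReal_ne_top),
    integral_smul_measure, integral_smul_measure, integral_dirac, integral_dirac,
    ENNReal.toReal_ofReal hp.1, ENNReal.toReal_ofReal (by linarith [hp.2]), smul_eq_mul, smul_eq_mul]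

theorem biasedCoin_real {p : ℝ} (hp : p ∈ Set.Icc (0 : ℝ) 1) (S : Set (ULift.{u} Bool)) :
    (biasedCoin p).real S = p * S.indicator 1 ⟨true⟩ + (1 - p) * S.indicator 1 ⟨false⟩ := by
  rw [← integral_biasedCoin hp, integral_indicator_one (MeasurableSet.of_discrete)]

/-- The probability that generalized randomized response with parameters `E`, `t` outputs `true`,
on the distinguished input if `b` holds and on all other inputs if not. -/
noncomputable def grrProb (E t : ℝ) (b : Prop) : ℝ :=
  open Classical in if b then qRR E t else Real.exp (-t) * qRR E t

theorem grrProb_mem {E t : ℝ} (hE : 0 < E) (h0 : 0 ≤ t) (h1 : t ≤ E) (b : Prop) :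
    grrProb E t b ∈ Set.Icc (0 : ℝ) 1 := by
  have h := qRR_mem_Icc hE h0 h1
  unfold grrProb
  split_ifs
  · exact h
  · exact ⟨mul_nonneg (Real.exp_pos _).le h.1,
      mul_le_one₀ (Real.exp_le_one_iff.2 (by linarith)) h.1 h.2⟩

theorem RatioBounded.biasedCoin {E t : ℝ} (hE : 0 < E) (h0 : 0 ≤ t) (h1 : t ≤ E) :
    RatioBounded E t (biasedCoin.{u} (grrProb E t True)) (biasedCoin.{u} (grrProb E t False)) := by
  have hq := qRR_mem_Icc hE h0 h1
  have hc := one_sub_exp_neg_mul_qRR hE t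
  have e1 : Real.exp t * Real.exp (-t) = 1 := by rw [← Real.exp_add]; simp
  have e2 : Real.exp t * Real.exp (E - t) = Real.exp E := by rw [← Real.exp_add]; ring_nf
  have e3 : Real.exp (t - E) * Real.exp (-t) = Real.exp (-E) := by rw [← Real.exp_add]; ring_nf
  have e4 : Real.exp (t - E) * Real.exp (E - t) = 1 := by rw [← Real.exp_add]; simp
  have hE1 : 1 ≤ Real.exp E := Real.one_le_exp hE.le
  have hE2 : Real.exp (-E) ≤ 1 := Real.exp_le_one_iff.2 (by linarith)
  constructor <;> intro S _ <;>
  rw [biasedCoin_real (grrProb_mem hE h0 h1 _), biasedCoin_real (grrProb_mem hE h0 h1 _)] <;>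
  simp only [grrProb, if_true, if_false] <;> rw [hc] <;>
  set a : ℝ := S.indicator 1 ⟨true⟩ with ha <;>
  set b : ℝ := S.indicator 1 ⟨false⟩ with hb <;>
  have ha0 : 0 ≤ qRR E t * a := mul_nonneg hq.1 (Set.indicator_nonneg (by simp) _) <;>
  have hb0 : 0 ≤ (1 - qRR E t) * b :=
    mul_nonneg (by linarith [hq.2]) (Set.indicator_nonneg (by simp) _)
  · calc _ ≤ 1 * (qRR E t * a) + Real.exp E * ((1 - qRR E t) * b) := by nlinarith
      _ = _ := by rw [← e2, ← e1]; ring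
  · calc _ = Real.exp (-E) * (qRR E t * a) + 1 * ((1 - qRR E t) * b) := by rw [← e3, ← e4]; ring
      _ ≤ _ := by nlinarith

/-- The positive functionals `P - exp (t - E) • Q` and `exp t • Q - P` dominate the pair `P`, `Q`
by generalized randomized response. -/
theorem RatioBounded.integral_sub_le {Y : Type*} [MeasurableSpace Y] {E t : ℝ} {P Q : Measure Y}
    [IsProbabilityMeasure P] [IsProbabilityMeasure Q] (h : RatioBounded E t P Q) (hE : 0 < E)
    {g k : Y → ℝ} (hgP : Integrable g P) (hgQ : Integrable g Q) (hkP : Integrable k P)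
    (hkQ : Integrable k Q) {s c₁ c₂ : ℝ} (h₁ : ∀ y, g y - Real.exp (s - t) * k y ≤ c₁)
    (h₂ : ∀ y, g y - Real.exp (s + E - t) * k y ≤ c₂) :
    ∫ y, g y ∂P - Real.exp s * ∫ y, k y ∂Q ≤ qRR E t * c₁ + (1 - qRR E t) * c₂ := by
  have hle : P ≤ ENNReal.ofReal (Real.exp t) • Q := by
    refine Measure.le_iff.2 fun S hS => ?_
    have := h.le S hS
    rw [Measure.smul_apply, smul_eq_mul, ← ofReal_measureReal, ← ofReal_measureReal,
      ← ENNReal.ofReal_mul (Real.exp_pos _).le]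
    exact ENNReal.ofReal_le_ofReal this
  have hge : ENNReal.ofReal (Real.exp (t - E)) • Q ≤ P := by
    refine Measure.le_iff.2 fun S hS => ?_
    have := h.ge S hS
    rw [Measure.smul_apply, smul_eq_mul, ← ofReal_measureReal, ← ofReal_measureReal,
      ← ENNReal.ofReal_mul (Real.exp_pos _).le]
    exact ENNReal.ofReal_le_ofReal this
  have i : ∀ (μ : Measure Y) [IsProbabilityMeasure μ], Integrable g μ → Integrable k μ →
      ∀ c r : ℝ, ∫ y, (c - (g y - r * k y)) ∂μ = c - (∫ y, g y ∂μ - r * ∫ y, k y ∂μ) := by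
    intro μ _ hg hk c r
    have hgk : Integrable (fun y => g y - r * k y) μ := hg.sub (hk.const_mul r)
    rw [integral_sub (integrable_const _) hgk, integral_sub hg (hk.const_mul r),
      integral_const_mul]
    simp
  have p₁ := integral_mono_measure hge
    (f := fun y => c₁ - (g y - Real.exp (s - t) * k y))
    (ae_of_all _ fun y => sub_nonneg.2 (h₁ y))
    ((integrable_const _).sub (hgP.sub (hkP.const_mul _)))
  have p₂ := integral_mono_measure hle
    (f := fun y => c₂ - (g y - Real.exp (s + E - t) * k y))
    (ae_of_all _ fun y => sub_nonneg.2 (h₂ y))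
    (((integrable_const _).sub (hgQ.sub (hkQ.const_mul _))).smul_measure ENNReal.ofReal_ne_top)
  rw [integral_smul_measure, ENNReal.toReal_ofReal (Real.exp_pos _).le, smul_eq_mul, i P hgP hkP,
    i Q hgQ hkQ] at p₁ p₂
  have hD : 0 < 1 - Real.exp (-E) := by simpa using hE
  have e1 : Real.exp (t - E) = Real.exp t * Real.exp (-E) := by rw [← Real.exp_add]; ring_nf
  have e2 : Real.exp (s + E - t) = Real.exp s * (Real.exp (-E))⁻¹ * (Real.exp t)⁻¹ := by
    rw [← Real.exp_neg, ← Real.exp_neg, ← Real.exp_add, ← Real.exp_add]; ring_nf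
  have e3 : Real.exp (s - t) = Real.exp s * (Real.exp t)⁻¹ := by
    rw [← Real.exp_neg, ← Real.exp_add]; ring_nf
  have ht := Real.exp_pos t
  have hE' := Real.exp_pos (-E)
  rw [e1, e3] at p₁
  rw [e2] at p₂
  rw [qRR, e1]
  -- With weight e^(-E), the cross terms ∫ k dP and ∫ g dQ cancel in the sum of the two
  -- inequalities.
  have p₂' := mul_le_mul_of_nonneg_left p₂ hE'.le
  rw [← sub_nonneg] at p₁ p₂'
  rw [← sub_nonneg]
  refine (div_nonneg (add_nonneg p₁ p₂') hD.le).trans_eq ?_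
  field_simp
  ring

/-! ### BR and DP as constraints on the range of the likelihood ratio. -/

/-- Take e^t to be the supremum of P(S)/Q(S). Comparison with the whole space puts it between 1 and
e^ε. Bounded range says that every ratio is at most e^ε times any other, and the supremum over the
first gives the lower bound. -/
theorem exists_ratioBounded {Y : Type*} [MeasurableSpace Y] {P Q : Measure Y}
    [IsProbabilityMeasure P] [IsProbabilityMeasure Q] {ε : ℝ}
    (h : ∀ S₁ S₂ : Set Y, MeasurableSet S₁ → MeasurableSet S₂ →
      P.real S₁ * Q.real S₂ ≤ Real.exp ε * (P.real S₂ * Q.real S₁)) :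
    ∃ t, 0 ≤ t ∧ t ≤ ε ∧ RatioBounded ε t P Q := by
  set T : Set ℝ := {r | ∃ S, MeasurableSet S ∧ 0 < Q.real S ∧ r = P.real S / Q.real S} with hT
  have hbdd : ∀ S, MeasurableSet S → P.real S ≤ Real.exp ε * Q.real S := fun S hS => by
    simpa using h S Set.univ hS MeasurableSet.univ
  have hub : ∀ r ∈ T, r ≤ Real.exp ε := by
    rintro r ⟨S, hS, hpos, rfl⟩
    exact (div_le_iff₀ hpos).2 (hbdd S hS)
  have hone : (1 : ℝ) ∈ T := ⟨Set.univ, MeasurableSet.univ, by simp, by simp⟩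
  have hB : BddAbove T := ⟨_, hub⟩
  have h1 : 1 ≤ sSup T := le_csSup hB hone
  have hE : sSup T ≤ Real.exp ε := csSup_le ⟨1, hone⟩ hub
  have hexp : Real.exp (Real.log (sSup T)) = sSup T := Real.exp_log (by linarith)
  refine ⟨Real.log (sSup T), Real.log_nonneg h1, (Real.log_le_iff_le_exp (by linarith)).2 hE,
    fun S hS => ?_, fun S hS => ?_⟩
  · rw [hexp]
    rcases (measureReal_nonneg (μ := Q) (s := S)).eq_or_lt with h0 | h0
    · have := hbdd S hS
      rw [← h0] at this ⊢
      simpa using this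
    · exact (div_le_iff₀ h0).1 (le_csSup hB ⟨S, hS, h0, rfl⟩)
  · rw [Real.exp_sub, hexp, div_mul_eq_mul_div, div_le_iff₀ (Real.exp_pos _)]
    rcases (measureReal_nonneg (μ := Q) (s := S)).eq_or_lt with h0 | h0
    · rw [← h0, mul_zero]
      positivity
    · rw [← le_div_iff₀ h0]
      refine csSup_le ⟨1, hone⟩ ?_
      rintro r ⟨S', hS', hpos, rfl⟩
      rw [div_le_div_iff₀ hpos h0]
      linarith [h S' S hS' hS]

/-- The mechanisms whose likelihood ratios on neighbors satisfy `RatioBounded E t` for some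
`t ∈ T`. -/
def ratioClass {X : Type v} (Nbr : X → X → Prop) (E : ℝ) (T : Set ℝ) : Set (Mechanism.{u, v} X) :=
  {M | ∀ x x', Nbr x x' → ∃ t ∈ T, RatioBounded E t (M.law x) (M.law x')}

theorem classBR_subset_ratioClass {X : Type v} (Nbr : X → X → Prop) (ε : ℝ) :
    classBR.{u, v} Nbr ε ⊆ ratioClass Nbr ε (Set.Icc 0 ε) := fun _ hM x x' hx =>
  let ⟨t, h0, h1, h⟩ := exists_ratioBounded (hM x x' hx)
  ⟨t, ⟨h0, h1⟩, h⟩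

theorem classDP_subset_ratioClass {X : Type v} {Nbr : X → X → Prop}
    (hsymm : ∀ x x', Nbr x x' → Nbr x' x) (ε : ℝ) :
    classDP.{u, v} Nbr ε ⊆ ratioClass Nbr (2 * ε) {ε} := by
  refine fun M hM x x' hx => ⟨ε, rfl, fun S hS => by simpa using hM x x' hx S hS, fun S hS => ?_⟩
  have := hM x' x (hsymm _ _ hx) S hS
  rw [show ε - 2 * ε = -ε by ring, Real.exp_neg, inv_mul_le_iff₀ (Real.exp_pos _)]
  simpa using this

/-! ### The best single BR mechanism at a given threshold. -/

/-- The parameter of generalized randomized response that is optimal at threshold `exp s`. -/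
noncomputable def bestParam (ε s : ℝ) : ℝ := max 0 (min ε ((s + ε) / 2))

theorem bestParam_mem {ε : ℝ} (hε : 0 < ε) (s : ℝ) : bestParam ε s ∈ Set.Icc 0 ε :=
  ⟨le_max_left _ _, max_le hε.le (min_le_left _ _)⟩

/-- The optimal privacy parameter of the class of `ε`-bounded range mechanisms at level `s`. -/
noncomputable def brDelta (ε s : ℝ) : ℝ :=
  qRR ε (bestParam ε s) * (1 - Real.exp (s - bestParam ε s))

theorem brDelta_of_ge {ε s : ℝ} (hε : 0 < ε) (hs : ε ≤ s) : brDelta ε s = 0 := by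
  have : bestParam ε s = ε := by
    rw [bestParam, min_eq_left (by linarith), max_eq_right hε.le]
  simp [brDelta, this, qRR]

theorem brDelta_of_le {ε s : ℝ} (hε : 0 < ε) (hs : s ≤ -ε) : brDelta ε s = 1 - Real.exp s := by
  have : bestParam ε s = 0 := by
    rw [bestParam, max_eq_left ((min_le_right _ _).trans (by linarith))]
  have hD : 0 < 1 - Real.exp (-ε) := by simpa using hε
  simp [brDelta, this, qRR, hD.ne']

theorem brDelta_of_mem {ε s : ℝ} (h₁ : -ε ≤ s) (h₂ : s ≤ ε) :
    brDelta ε s = (1 - Real.exp ((s - ε) / 2)) ^ 2 / (1 - Real.exp (-ε)) := by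
  have : bestParam ε s = (s + ε) / 2 := by
    rw [bestParam, min_eq_right (by linarith), max_eq_right (by linarith)]
  rw [brDelta, this, qRR, show (s + ε) / 2 - ε = (s - ε) / 2 by ring,
    show s - (s + ε) / 2 = (s - ε) / 2 by ring]
  ring

/-- The left side is the best event for randomized response with parameter t. For -ε < s < ε, when
this event is everything or just `true`, the gap to `brDelta` is a perfect square up to a positive
factor; in the second case it vanishes at t = (s + ε)/2. -/
theorem randomizedResponse_le_brDelta {ε s t : ℝ} (hε : 0 < ε) (h0 : 0 ≤ t) (h1 : t ≤ ε) :
    qRR ε t * max 0 (1 - Real.exp (s - t)) + (1 - qRR ε t) * max 0 (1 - Real.exp (s + ε - t)) ≤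
      brDelta ε s := by
  have hD : 0 < 1 - Real.exp (-ε) := by simpa using hε
  rcases le_or_gt ε s with hs | hs
  · rw [brDelta_of_ge hε hs, max_eq_left (by simp; linarith), max_eq_left (by simp; linarith)]
    simp
  have hall : qRR ε t * (1 - Real.exp (s - t)) + (1 - qRR ε t) * (1 - Real.exp (s + ε - t)) =
      1 - Real.exp s := by
    have e1 : Real.exp (s + ε - t) = Real.exp s * Real.exp (ε - t) := by
      rw [← Real.exp_add]; ring_nf
    have e2 : Real.exp (s - t) = Real.exp s * Real.exp (-t) := by rw [← Real.exp_add]; ring_nf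
    have := one_sub_exp_neg_mul_qRR hε t
    rw [e1, e2]
    linear_combination Real.exp s * this
  rcases le_or_gt s (-ε) with hs' | hs'
  · rw [brDelta_of_le hε hs', max_eq_right (by simp; linarith), max_eq_right (by simp; linarith),
      hall]
  have hσ : Real.exp s = Real.exp (s / 2) ^ 2 := by rw [← Real.exp_nat_mul]; ring_nf
  have hm : Real.exp (-ε) = Real.exp (-ε / 2) ^ 2 := by rw [← Real.exp_nat_mul]; ring_nf
  have hw : Real.exp t = Real.exp (t / 2) ^ 2 := by rw [← Real.exp_nat_mul]; ring_nf
  have e1 : Real.exp ((s - ε) / 2) = Real.exp (s / 2) * Real.exp (-ε / 2) := by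
    rw [← Real.exp_add]; ring_nf
  rw [brDelta_of_mem hs'.le hs.le, le_div_iff₀ hD]
  have hx : 0 ≤ 1 - Real.exp ((s - ε) / 2) := by simp; linarith
  rcases le_or_gt (s + ε - t) 0 with h | h
  · rw [max_eq_right (by simp; linarith), max_eq_right (by simpa using h), hall, e1, hσ, hm]
    nlinarith [sq_nonneg (Real.exp (s / 2) - Real.exp (-ε / 2))]
  · rw [max_eq_left (b := 1 - Real.exp (s + ε - t)) (by simpa using h.le), mul_zero, add_zero]
    rcases le_or_gt (s - t) 0 with h' | h'
    · have e2 : Real.exp (t - ε) = Real.exp (t / 2) ^ 2 * Real.exp (-ε / 2) ^ 2 := by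
        rw [← hw, ← hm, ← Real.exp_add]; ring_nf
      have e3 : Real.exp (s - t) = Real.exp (s / 2) ^ 2 / Real.exp (t / 2) ^ 2 := by
        rw [← hw, ← hσ, ← Real.exp_sub]
      rw [max_eq_right (by simpa using h'), qRR, div_mul_eq_mul_div, div_mul_cancel₀ _ hD.ne', e1,
        e2, e3, ← sub_nonneg]
      have := Real.exp_pos (t / 2)
      have key : 0 ≤ (Real.exp (t / 2) ^ 2 * Real.exp (-ε / 2) - Real.exp (s / 2)) ^ 2 /
        Real.exp (t / 2) ^ 2 := by positivity
      refine key.trans_eq ?_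
      field_simp
      ring
    · rw [max_eq_left (by simpa using h'.le), mul_zero, zero_mul]
      positivity

theorem IsBR.real_sub_le_brDelta {X : Type v} {Nbr : X → X → Prop} {M : Mechanism.{u, v} X} {ε : ℝ}
    (hε : 0 < ε) (hM : IsBR Nbr M ε) {x x' : X} (hx : Nbr x x') {S : Set M.Out}
    (hS : MeasurableSet S) (s : ℝ) :
    (M.law x).real S - Real.exp s * (M.law x').real S ≤ brDelta ε s := by
  obtain ⟨t, h0, h1, h⟩ := exists_ratioBounded (hM x x' hx)
  refine le_trans ?_ (randomizedResponse_le_brDelta hε h0 h1)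
  have hi : ∀ (μ : Measure M.Out) [IsProbabilityMeasure μ],
      Integrable (S.indicator (1 : M.Out → ℝ)) μ := fun μ _ => (integrable_const 1).indicator hS
  have hind : ∀ (c : ℝ) y, S.indicator (1 : M.Out → ℝ) y - c * S.indicator (1 : M.Out → ℝ) y ≤
      max 0 (1 - c) := fun c y => by
    by_cases hy : y ∈ S <;> simp [hy]
  have := h.integral_sub_le hε (hi _) (hi _) (hi _) (hi _) (s := s) (hind _) (hind _)
  rwa [integral_indicator_one hS, integral_indicator_one hS] at this

/-! ### Compositions and the upper bound by backward induction. -/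

section Composition

variable {Y Z W : Type*} [MeasurableSpace Y] [MeasurableSpace Z] [MeasurableSpace W]

theorem measurable_kernel_real_preimage (η : Kernel Y Z) [IsMarkovKernel η] {S : Set (Y × Z)}
    (hS : MeasurableSet S) : Measurable fun y => (η y).real (Prod.mk y ⁻¹' S) :=
  (Kernel.measurable_kernel_prodMk_left hS).ennreal_toReal

theorem integrable_kernel_real_preimage (η : Kernel Y Z) [IsMarkovKernel η] {S : Set (Y × Z)}
    (hS : MeasurableSet S) (μ : Measure Y) [IsFiniteMeasure μ] :
    Integrable (fun y => (η y).real (Prod.mk y ⁻¹' S)) μ :=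
  .of_bound (measurable_kernel_real_preimage η hS).aestronglyMeasurable 1
    (ae_of_all _ fun y => by
      rw [Real.norm_of_nonneg measureReal_nonneg]
      exact measureReal_le_one)

theorem compProd_real (μ : Measure Y) [IsProbabilityMeasure μ] (η : Kernel Y Z)
    [IsMarkovKernel η] {S : Set (Y × Z)} (hS : MeasurableSet S) :
    (μ ⊗ₘ η).real S = ∫ y, (η y).real (Prod.mk y ⁻¹' S) ∂μ := by
  simp only [measureReal_def]
  rw [integral_toReal (Kernel.measurable_kernel_prodMk_left hS).aemeasurable
    (ae_of_all _ fun y => measure_lt_top _ _), ← Measure.compProd_apply hS]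

theorem compProd_compProd_real (μ : Measure Y) [IsProbabilityMeasure μ] (κ : Kernel Y Z)
    [IsMarkovKernel κ] (η : Kernel (Y × Z) W) [IsMarkovKernel η] {S : Set ((Y × Z) × W)}
    (hS : MeasurableSet S) :
    ((μ ⊗ₘ κ) ⊗ₘ η).real S =
      ∫ y, ∫ z, (η (y, z)).real (Prod.mk (y, z) ⁻¹' S) ∂(κ y) ∂μ := by
  rw [compProd_real _ _ hS, Measure.integral_compProd (integrable_kernel_real_preimage η hS _)]

end Composition

/-- The value of generalized randomized response at threshold `exp s`, followed by a mechanism of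
value `f`. -/
noncomputable def grrValue (E t : ℝ) (f : ℝ → ℝ) (s : ℝ) : ℝ :=
  qRR E t * f (s - t) + (1 - qRR E t) * f (s + E - t)

/-- Keeps the real `sInf` and `sSup` meaningful: the set of admissible δ is nonempty and all optimal
values are at most 1. -/
theorem isDP_one {X : Type v} (Nbr : X → X → Prop) (M : Mechanism.{u, v} X) (ε : ℝ) :
    IsDP Nbr M ε 1 := fun x x' _ S _ => by
  have h₁ : (M.law x).real S ≤ 1 := measureReal_le_one
  have h₂ : 0 ≤ Real.exp ε * (M.law x').real S := by positivity
  linarith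

theorem deltaOptMech_le {X : Type v} {Nbr : X → X → Prop} {M : Mechanism.{u, v} X} {ε δ : ℝ}
    (hδ : 0 ≤ δ) (h : IsDP Nbr M ε δ) : deltaOptMech Nbr M ε ≤ δ :=
  csInf_le ⟨0, fun _ h => h.1⟩ ⟨hδ, h⟩

theorem le_deltaOpt {X : Type v} {Nbr : X → X → Prop} {C : Set (Mechanism.{u, v} X)}
    {M : Mechanism.{u, v} X} (hM : M ∈ C) {x x' : X} (hx : Nbr x x') {S : Set M.Out}
    (hS : MeasurableSet S) (ε : ℝ) :
    (M.law x).real S - Real.exp ε * (M.law x').real S ≤ deltaOpt Nbr C ε := by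
  have h₁ : (M.law x).real S - Real.exp ε * (M.law x').real S ≤ deltaOptMech Nbr M ε :=
    le_csInf ⟨1, zero_le_one, isDP_one Nbr M ε⟩ fun δ hδ => by linarith [hδ.2 x x' hx S hS]
  refine h₁.trans (le_csSup ⟨1, ?_⟩ ⟨M, hM, rfl⟩)
  rintro _ ⟨M', -, rfl⟩
  exact deltaOptMech_le zero_le_one (isDP_one Nbr M' ε)

/-- Backward induction: for every history the last step is worth at most `brDelta` at its current
threshold, and `RatioBounded.integral_sub_le` carries such bounds through the second and then the
first step. The bounds `c₁` and `c₂` are separate because the parameter of the second step may vary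
with the first outcome. -/
theorem deltaOpt_adaptive₃_le {X : Type v} {Nbr : X → X → Prop} {C₁ C₂ : Set (Mechanism.{u, v} X)}
    {ε E₁ E₂ s δ : ℝ} {T₁ T₂ : Set ℝ} (hε : 0 < ε) (hE₁ : 0 < E₁) (hE₂ : 0 < E₂)
    (h₁ : C₁ ⊆ ratioClass Nbr E₁ T₁) (h₂ : C₂ ⊆ ratioClass Nbr E₂ T₂) (hδ : 0 ≤ δ)
    (hv : ∀ t₁ ∈ T₁, ∃ c₁ c₂, (∀ t ∈ T₂, grrValue E₂ t (brDelta ε) (s - t₁) ≤ c₁) ∧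
      (∀ t ∈ T₂, grrValue E₂ t (brDelta ε) (s + E₁ - t₁) ≤ c₂) ∧
      qRR E₁ t₁ * c₁ + (1 - qRR E₁ t₁) * c₂ ≤ δ) :
    deltaOpt Nbr (adaptive₃ C₁ C₂ (classBR Nbr ε)) s ≤ δ := by
  refine Real.sSup_le ?_ hδ
  rintro _ ⟨_, ⟨_, ⟨M₁, hM₁, M₂, hM₂, rfl⟩, M₃, hM₃, rfl⟩, rfl⟩
  refine deltaOptMech_le hδ fun x x' hx (S : Set ((M₁.Out × M₂.Out) × M₃.Out)) hS => ?_
  obtain ⟨t₁, ht₁, hr₁⟩ := h₁ hM₁ x x' hx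
  obtain ⟨c₁, c₂, hc₁, hc₂, hc⟩ := hv t₁ ht₁
  let η : X → Kernel (M₁.Out × M₂.Out) M₃.Out := M₃.law
  have : ∀ a, IsMarkovKernel (η a) := fun a => M₃.isMarkovKernel a
  have key : (((M₁.law x) ⊗ₘ (M₂.law x)) ⊗ₘ (η x)).real S -
      Real.exp s * (((M₁.law x') ⊗ₘ (M₂.law x')) ⊗ₘ (η x')).real S ≤ δ := by
    rw [compProd_compProd_real _ _ _ hS, compProd_compProd_real _ _ _ hS]
    let F : X → M₁.Out × M₂.Out → ℝ := fun a p => (η a p).real (Prod.mk p ⁻¹' S)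
    have hF : ∀ a, Measurable (F a) := fun a => measurable_kernel_real_preimage (η a) hS
    have hF0 : ∀ a p, 0 ≤ F a p := fun a p => measureReal_nonneg
    have hF1 : ∀ a p, F a p ≤ 1 := fun a p => measureReal_le_one
    have hFi : ∀ a y (ν : Measure M₂.Out) [IsProbabilityMeasure ν],
        Integrable (fun z => F a (y, z)) ν := fun a y ν _ =>
      .of_bound ((hF a).comp measurable_prodMk_left).aestronglyMeasurable 1
        (ae_of_all _ fun z => by
          rw [Real.norm_of_nonneg (hF0 _ _)]
          exact hF1 _ _)
    have hGi : ∀ a (μ : Measure M₁.Out) [IsProbabilityMeasure μ],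
        Integrable (fun y => ∫ z, F a (y, z) ∂(M₂.law a y)) μ := fun a μ _ =>
      .of_bound ((hF a).stronglyMeasurable.integral_kernel_prod_right').aestronglyMeasurable 1
        (ae_of_all _ fun y => by
          rw [Real.norm_of_nonneg (integral_nonneg fun z => hF0 _ _)]
          simpa using integral_mono (hFi a y (M₂.law a y)) (integrable_const (1 : ℝ)) fun z => hF1 a (y, z))
    have hlast : ∀ (r : ℝ) p, F x p - Real.exp r * F x' p ≤ brDelta ε r := fun r p =>
      IsBR.real_sub_le_brDelta hε (hM₃ p) hx (measurable_prodMk_left hS) r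
    have hmid : ∀ (r c : ℝ), (∀ t ∈ T₂, grrValue E₂ t (brDelta ε) r ≤ c) → ∀ y,
        ∫ z, F x (y, z) ∂(M₂.law x y) - Real.exp r * ∫ z, F x' (y, z) ∂(M₂.law x' y) ≤ c := by
      intro r c hrc y
      obtain ⟨t, ht, hr⟩ := h₂ (hM₂ y) x x' hx
      refine le_trans ?_ (hrc t ht)
      exact RatioBounded.integral_sub_le (P := M₂.law x y) (Q := M₂.law x' y) hr hE₂ (hFi _ _ _)
        (hFi _ _ _) (hFi _ _ _) (hFi _ _ _) (fun z => hlast _ _) (fun z => hlast _ _)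
    exact (hr₁.integral_sub_le hE₁ (hGi _ _) (hGi _ _) (hGi _ _) (hGi _ _) (hmid _ _ hc₁)
      (hmid _ _ hc₂)).trans hc
  have key' : ((Mechanism.andThen _ M₃).law x).real S -
      Real.exp s * ((Mechanism.andThen _ M₃).law x').real S ≤ δ := key
  linarith

/-! ### Randomized response mechanisms attaining the bound. -/

/-- Generalized randomized response, telling `x₀` apart from the other inputs. -/
noncomputable def grr {X : Type v} (x₀ : X) (E t : ℝ) : Mechanism.{u, v} X where
  Out := ULift.{u} Bool
  law := fun x => biasedCoin (grrProb E t (x = x₀))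

/-- The law of generalized randomized response with a parameter that depends on the previous
outcome. -/
noncomputable def grrKernel {Y : Type*} [MeasurableSpace Y] [DiscreteMeasurableSpace Y] (E : ℝ)
    (t : Y → ℝ) (b : Prop) : Kernel Y (ULift.{u} Bool) :=
  ⟨fun y => biasedCoin (grrProb E (t y) b), .of_discrete⟩

instance {Y : Type*} [MeasurableSpace Y] [DiscreteMeasurableSpace Y] (E : ℝ) (t : Y → ℝ)
    (b : Prop) : IsMarkovKernel (grrKernel.{u} E t b) :=
  ⟨fun _ => inferInstanceAs (IsProbabilityMeasure (biasedCoin _))⟩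

/-- Generalized randomized response with a parameter that depends on the previous outcome. -/
noncomputable def adaptiveGrr {X : Type v} {Y : Type u} [MeasurableSpace Y]
    [DiscreteMeasurableSpace Y] (x₀ : X) (E : ℝ) (t : Y → ℝ) : AdaptiveMechanism.{u, v} X Y where
  Out := ULift.{u} Bool
  law := fun x => grrKernel E t (x = x₀)

theorem grr_mem_classBR {X : Type v} (Nbr : X → X → Prop) (x₀ : X) {ε t : ℝ} (hε : 0 < ε)
    (ht : t ∈ Set.Icc 0 ε) : grr.{u, v} x₀ ε t ∈ classBR Nbr ε := by
  have h := RatioBounded.biasedCoin.{u} hε ht.1 ht.2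
  have key : ∀ {P Q : Measure (ULift.{u} Bool)}, RatioBounded ε t P Q → ∀ {S₁ S₂ : Set _},
      MeasurableSet S₁ → MeasurableSet S₂ →
      P.real S₁ * Q.real S₂ ≤ Real.exp ε * (P.real S₂ * Q.real S₁) := by
    intro P Q h S₁ S₂ h₁ h₂
    have e : Real.exp t * (Real.exp (ε - t)) = Real.exp ε := by rw [← Real.exp_add]; ring_nf
    have e' : Real.exp (ε - t) * Real.exp (t - ε) = 1 := by rw [← Real.exp_add]; simp
    have hb : Q.real S₂ ≤ Real.exp (ε - t) * P.real S₂ := by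
      have := mul_le_mul_of_nonneg_left (h.ge S₂ h₂) (Real.exp_pos (ε - t)).le
      rwa [← mul_assoc, e', one_mul] at this
    calc _ ≤ (Real.exp t * Q.real S₁) * (Real.exp (ε - t) * P.real S₂) :=
          mul_le_mul (h.le S₁ h₁) hb measureReal_nonneg (by positivity)
      _ = _ := by rw [← e]; ring
  have same : ∀ (P : Measure (ULift.{u} Bool)) (S₁ S₂ : Set _),
      P.real S₁ * P.real S₂ ≤ Real.exp ε * (P.real S₂ * P.real S₁) := fun P S₁ S₂ => by
    rw [mul_comm (P.real S₁)]
    exact le_mul_of_one_le_left (by positivity) (Real.one_le_exp hε.le)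
  intro x x' _ (S₁ : Set (ULift.{u} Bool)) (S₂ : Set (ULift.{u} Bool)) h₁ h₂
  by_cases hx : x = x₀ <;> by_cases hx' : x' = x₀ <;> simp only [grr, hx, hx']
  · exact same _ _ _
  · exact key h h₁ h₂
  · have := key h h₂ h₁
    rw [mul_comm] at this
    exact this.trans_eq (congrArg _ (mul_comm _ _))
  · exact same _ _ _

theorem grr_mem_classDP {X : Type v} (Nbr : X → X → Prop) (x₀ : X) {ε : ℝ} (hε : 0 < ε) :
    grr.{u, v} x₀ (2 * ε) ε ∈ classDP Nbr ε := by
  have h := RatioBounded.biasedCoin.{u} (E := 2 * ε) (t := ε) (by linarith) hε.le (by linarith)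
  have same : ∀ (P : Measure (ULift.{u} Bool)) (S : Set _), P.real S ≤ Real.exp ε * P.real S + 0 :=
    fun P S => by
      rw [add_zero]
      exact le_mul_of_one_le_left (by positivity) (Real.one_le_exp hε.le)
  intro x x' _ (S : Set (ULift.{u} Bool)) hS
  by_cases hx : x = x₀ <;> by_cases hx' : x' = x₀ <;> simp only [grr, hx, hx']
  · exact same _ _
  · rw [add_zero]
    exact h.le S hS
  · have := h.ge S hS
    rw [show ε - 2 * ε = -ε by ring, Real.exp_neg, inv_mul_le_iff₀ (Real.exp_pos _)] at this
    rwa [add_zero]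
  · exact same _ _

/-- The equality case of `RatioBounded.integral_sub_le`: randomized response attains its own bound.
-/
theorem integral_biasedCoin_sub {E t : ℝ} (hE : 0 < E) (h0 : 0 ≤ t) (h1 : t ≤ E) (s : ℝ)
    (g k : ULift.{u} Bool → ℝ) :
    ∫ y, g y ∂(biasedCoin (grrProb E t True)) -
        Real.exp s * ∫ y, k y ∂(biasedCoin (grrProb E t False)) =
      qRR E t * (g ⟨true⟩ - Real.exp (s - t) * k ⟨true⟩) +
        (1 - qRR E t) * (g ⟨false⟩ - Real.exp (s + E - t) * k ⟨false⟩) := by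
  rw [integral_biasedCoin (grrProb_mem hE h0 h1 _), integral_biasedCoin (grrProb_mem hE h0 h1 _)]
  simp only [grrProb, if_true, if_false]
  rw [one_sub_exp_neg_mul_qRR hE t, show s - t = s + -t by ring, Real.exp_add s (-t),
    show s + E - t = s + (E - t) by ring, Real.exp_add s (E - t)]
  ring

theorem le_deltaOpt_adaptive₃ {X : Type v} {Nbr : X → X → Prop} {C₁ C₂ : Set (Mechanism.{u, v} X)}
    {ε E₁ E₂ t₁ : ℝ} (s : ℝ) {t₂ : Bool → ℝ} (hε : 0 < ε) (hE₁ : 0 < E₁) (hE₂ : 0 < E₂)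
    (ht₁ : t₁ ∈ Set.Icc 0 E₁) (ht₂ : ∀ b, t₂ b ∈ Set.Icc 0 E₂) {x x' : X} (hx : Nbr x x')
    (hne : x ≠ x') (h₁ : grr x E₁ t₁ ∈ C₁) (h₂ : ∀ b, grr x E₂ (t₂ b) ∈ C₂) :
    qRR E₁ t₁ * grrValue E₂ (t₂ true) (brDelta ε) (s - t₁) +
        (1 - qRR E₁ t₁) * grrValue E₂ (t₂ false) (brDelta ε) (s + E₁ - t₁) ≤
      deltaOpt Nbr (adaptive₃ C₁ C₂ (classBR Nbr ε)) s := by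
  -- `next` updates the threshold after one outcome, so `r` is the threshold facing the last
  -- mechanism, which is then tuned to it.
  let next : ℝ → ℝ → ℝ → Bool → ℝ := fun E t r b => if b then r - t else r + E - t
  let r : ULift.{u} Bool × ULift.{u} Bool → ℝ := fun p =>
    next E₂ (t₂ p.1.down) (next E₁ t₁ s p.1.down) p.2.down
  let M₁ : Mechanism.{u, v} X := grr x E₁ t₁
  let M₂ : AdaptiveMechanism.{u, v} X (ULift.{u} Bool) := adaptiveGrr x E₂ fun y => t₂ y.down
  let M₃ : AdaptiveMechanism.{u, v} X (ULift.{u} Bool × ULift.{u} Bool) :=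
    adaptiveGrr x ε fun p => bestParam ε (r p)
  let M : Mechanism.{u, v} X := (M₁.andThen M₂).andThen M₃
  have hM : M ∈ adaptive₃ C₁ C₂ (classBR Nbr ε) :=
    ⟨M₁.andThen M₂, ⟨M₁, h₁, M₂, fun y => h₂ y.down, rfl⟩, M₃,
      fun p => grr_mem_classBR Nbr x hε (bestParam_mem hε (r p)), rfl⟩
  -- This one event is optimal after every history: at very low or high thresholds `bestParam` is
  -- clamped to 0 or ε, where `true` has probability 1 or 0 on both inputs.
  let S : Set ((ULift.{u} Bool × ULift.{u} Bool) × ULift.{u} Bool) := {p | p.2 = ⟨true⟩}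
  have hS : MeasurableSet S := measurable_snd (MeasurableSet.singleton (⟨true⟩ : ULift.{u} Bool))
  refine le_of_eq_of_le ?_ (le_deltaOpt hM hx (S := S) hS s)
  have hlaw : ∀ a, (M.law a).real S =
      ∫ y, ∫ z, (biasedCoin (grrProb ε (bestParam ε (r (y, z))) (a = x))).real {⟨true⟩}
        ∂(biasedCoin (grrProb E₂ (t₂ y.down) (a = x))) ∂(biasedCoin (grrProb E₁ t₁ (a = x))) :=
    fun a => compProd_compProd_real (biasedCoin _) (grrKernel E₂ (fun y => t₂ y.down) (a = x))
      (grrKernel ε (fun p => bestParam ε (r p)) (a = x)) hS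
  rw [hlaw, hlaw]
  simp only [hne.symm]
  rw [integral_biasedCoin_sub hE₁ ht₁.1 ht₁.2, integral_biasedCoin_sub hE₂ (ht₂ _).1 (ht₂ _).2,
    integral_biasedCoin_sub hE₂ (ht₂ _).1 (ht₂ _).2]
  have hlast : ∀ ρ : ℝ, (biasedCoin.{u} (grrProb ε (bestParam ε ρ) True)).real {⟨true⟩} -
      Real.exp ρ * (biasedCoin.{u} (grrProb ε (bestParam ε ρ) False)).real {⟨true⟩} =
      brDelta ε ρ := by
    intro ρ
    have ho := bestParam_mem hε ρ
    have := integral_biasedCoin_sub.{u} hε ho.1 ho.2 ρ (Set.indicator {⟨true⟩} 1)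
      (Set.indicator {⟨true⟩} 1)
    rw [integral_indicator_one .of_discrete, integral_indicator_one .of_discrete] at this
    rw [this]
    simp [brDelta]
  simp only [grrValue, ← hlast]
  simp [r, next]

/-! ### The branch values in terms of x, y and z. -/

theorem brDelta_nonneg {ε : ℝ} (hε : 0 < ε) (s : ℝ) : 0 ≤ brDelta ε s := by
  have hq := qRR_mem_Icc hε le_rfl hε.le
  exact (add_nonneg (mul_nonneg hq.1 (le_max_left _ _))
    (mul_nonneg (by linarith [hq.2]) (le_max_left _ _))).trans
    (randomizedResponse_le_brDelta (s := s) hε le_rfl hε.le)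

theorem grrValue_nonneg {E t : ℝ} {f : ℝ → ℝ} (hE : 0 < E) (ht : t ∈ Set.Icc 0 E)
    (hf : ∀ s, 0 ≤ f s) (s : ℝ) : 0 ≤ grrValue E t f s := by
  have hq := qRR_mem_Icc hE ht.1 ht.2
  exact add_nonneg (mul_nonneg hq.1 (hf _)) (mul_nonneg (by linarith [hq.2]) (hf _))

theorem qRR_two_mul_self_mem_Icc {ε : ℝ} (hε : 0 < ε) : qRR (2 * ε) ε ∈ Set.Icc (0 : ℝ) 1 :=
  qRR_mem_Icc (by linarith) hε.le (by linarith)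

/-- For t ≤ εg both remaining thresholds lie in [-ε, ε], where `brDelta` is quadratic. Beyond εg the
lower one drops below -ε, which turns x into y. -/
theorem grrValue_brDelta_eq_xFun {ε εg t : ℝ} (hεg : 0 ≤ εg) (hε : εg < ε) (h0 : 0 ≤ t)
    (ht : t ≤ εg) : qRR (2 * ε) ε * grrValue ε t (brDelta ε) (εg - ε) = xFun ε εg t := by
  have hD : 0 < 1 - Real.exp (-ε) := by simp; linarith
  have hq₁ : qRR ε ((εg - t) / 2) = (1 - Real.exp ((εg - t) / 2 - ε)) / (1 - Real.exp (-ε)) := rfl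
  have hq₂ : qRR ε ((εg + ε - t) / 2) = (1 - Real.exp ((εg + ε - t) / 2 - ε)) / (1 - Real.exp (-ε)) := rfl
  rw [grrValue, brDelta_of_mem (by linarith) (by linarith),
    brDelta_of_mem (by linarith) (by linarith), xFun, hq₁, hq₂, show (εg - ε - t - ε) / 2 = (εg - t) / 2 - ε by ring,
    show (εg - ε + ε - t - ε) / 2 = (εg + ε - t) / 2 - ε by ring]
  field_simp

theorem grrValue_brDelta_eq_yFun {ε εg t : ℝ} (hεg : 0 ≤ εg) (hε : εg < ε) (ht : εg ≤ t)
    (h1 : t ≤ ε) : qRR (2 * ε) ε * grrValue ε t (brDelta ε) (εg - ε) = yFun ε εg t := by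
  have hD : 0 < 1 - Real.exp (-ε) := by simp; linarith
  have hq : qRR ε ((εg + ε - t) / 2) = (1 - Real.exp ((εg + ε - t) / 2 - ε)) / (1 - Real.exp (-ε)) := rfl
  rw [grrValue, brDelta_of_le (by linarith) (by linarith),
    brDelta_of_mem (by linarith) (by linarith), yFun, hq,
    show (εg - ε + ε - t - ε) / 2 = (εg + ε - t) / 2 - ε by ring]
  field_simp

theorem grrValue_brDelta_eq_zFun {ε εg t : ℝ} (hεg : 0 ≤ εg) (hε : εg < ε) (ht : εg ≤ t)
    (h1 : t ≤ ε) : (1 - qRR (2 * ε) ε) * grrValue ε t (brDelta ε) (εg + ε) = zFun ε εg t := by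
  have hD : 0 < 1 - Real.exp (-ε) := by simp; linarith
  have hq : qRR ε (ε + (εg - t) / 2) = (1 - Real.exp (ε + (εg - t) / 2 - ε)) / (1 - Real.exp (-ε)) := rfl
  rw [grrValue, brDelta_of_mem (by linarith) (by linarith),
    brDelta_of_ge (by linarith) (by linarith), zFun, hq, show (εg + ε - t - ε) / 2 = ε + (εg - t) / 2 - ε by ring]
  field_simp
  ring

theorem grrValue_brDelta_eq_zero {ε εg t : ℝ} (hεg : 0 ≤ εg) (hε : εg < ε) (ht : t ≤ εg) :
    grrValue ε t (brDelta ε) (εg + ε) = 0 := by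
  rw [grrValue, brDelta_of_ge (by linarith) (by linarith),
    brDelta_of_ge (by linarith) (by linarith)]
  ring

/-! ### Closed forms, rational in m = e^(-ε/2), g = e^(εg/2) and w = e^(t/2). -/

theorem exp_half_sq (a : ℝ) : Real.exp (a / 2) ^ 2 = Real.exp a := by
  rw [← Real.exp_nat_mul]; ring_nf

theorem qRR_eq_exp_half (ε t : ℝ) : qRR ε t =
    (1 - Real.exp (-ε / 2) ^ 2 * Real.exp (t / 2) ^ 2) / (1 - Real.exp (-ε / 2) ^ 2) := by
  rw [exp_half_sq, exp_half_sq, ← Real.exp_add, qRR]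
  ring_nf

theorem qRR_two_mul_self {ε : ℝ} (hε : 0 < ε) :
    qRR (2 * ε) ε = 1 / (1 + Real.exp (-ε / 2) ^ 2) := by
  have hm : Real.exp (-ε / 2) < 1 := Real.exp_lt_one_iff.2 (by linarith)
  have h0 := Real.exp_pos (-ε / 2)
  have e : Real.exp (-(2 * ε)) = Real.exp (-ε / 2) ^ 4 := by rw [← Real.exp_nat_mul]; ring_nf
  have h2 : 0 < 1 - Real.exp (-ε / 2) ^ 2 := by nlinarith
  have h4 : 1 - Real.exp (-ε / 2) ^ 4 ≠ 0 := by nlinarith [sq_nonneg (Real.exp (-ε / 2))]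
  rw [qRR, show ε - 2 * ε = -ε by ring, ← exp_half_sq (-ε), e,
    div_eq_div_iff h4 (by positivity)]
  ring

section ClosedForms

variable {ε : ℝ} (εg t : ℝ)

theorem qRR_half_sub : qRR ε ((εg - t) / 2) =
    (1 - Real.exp (-ε / 2) ^ 2 * Real.exp (εg / 2) / Real.exp (t / 2)) /
      (1 - Real.exp (-ε / 2) ^ 2) := by
  rw [exp_half_sq, ← Real.exp_add, ← Real.exp_sub, qRR]
  ring_nf

theorem qRR_half_add_sub : qRR ε ((εg + ε - t) / 2) =
    (1 - Real.exp (-ε / 2) * Real.exp (εg / 2) / Real.exp (t / 2)) /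
      (1 - Real.exp (-ε / 2) ^ 2) := by
  rw [exp_half_sq, ← Real.exp_add, ← Real.exp_sub, qRR]
  ring_nf

theorem qRR_add_half_sub : qRR ε (ε + (εg - t) / 2) =
    (1 - Real.exp (εg / 2) / Real.exp (t / 2)) / (1 - Real.exp (-ε / 2) ^ 2) := by
  rw [exp_half_sq, ← Real.exp_sub, qRR]
  ring_nf

/-- The common denominator of the closed forms of `xFun`, `yFun` and `zFun`. -/
noncomputable def closedDenom (ε : ℝ) : ℝ :=
  (1 + Real.exp (-ε / 2) ^ 2) * (1 - Real.exp (-ε / 2) ^ 2) ^ 2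

theorem closedDenom_pos (hε : 0 < ε) : 0 < closedDenom ε := by
  have hm : Real.exp (-ε / 2) < 1 := Real.exp_lt_one_iff.2 (by linarith)
  have h0 := Real.exp_pos (-ε / 2)
  have h2 : 0 < 1 - Real.exp (-ε / 2) ^ 2 := by nlinarith
  unfold closedDenom
  positivity

theorem xFun_eq (hε : 0 < ε) (m g w : ℝ) (hm : m = Real.exp (-ε / 2)) (hg : g = Real.exp (εg / 2))
    (hw : w = Real.exp (t / 2)) : xFun ε εg t = ((1 - m ^ 2) * (1 + m ^ 4 * g ^ 2) -
      2 * m ^ 2 * g * (1 - m) * (1 / w + m * w)) / closedDenom ε := by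
  have hw0 : 0 < w := hw ▸ Real.exp_pos _
  have hm0 : 0 < m := hm ▸ Real.exp_pos _
  have hm1 : m < 1 := hm ▸ Real.exp_lt_one_iff.2 (by linarith)
  have h2 : 1 - m ^ 2 ≠ 0 := by nlinarith
  rw [xFun, qRR_two_mul_self hε, qRR_half_sub, qRR_half_add_sub, qRR_eq_exp_half, closedDenom,
    ← exp_half_sq (-ε), ← hm, ← hg, ← hw]
  field_simp
  ring

theorem yFun_eq (hε : 0 < ε) (m g w : ℝ) (hm : m = Real.exp (-ε / 2)) (hg : g = Real.exp (εg / 2))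
    (hw : w = Real.exp (t / 2)) : yFun ε εg t = ((1 - m ^ 2) * (1 + m ^ 4 * g ^ 2) + m ^ 4 * g ^ 2 -
      m ^ 2 + m ^ 4 * w ^ 2 - m ^ 2 * g ^ 2 / w ^ 2 - 2 * m ^ 3 * g * w + 2 * m ^ 3 * g / w) /
      closedDenom ε := by
  have hw0 : 0 < w := hw ▸ Real.exp_pos _
  have hm0 : 0 < m := hm ▸ Real.exp_pos _
  have hm1 : m < 1 := hm ▸ Real.exp_lt_one_iff.2 (by linarith)
  have h2 : 1 - m ^ 2 ≠ 0 := by nlinarith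
  have e : Real.exp (εg - ε - t) = g ^ 2 * m ^ 2 / w ^ 2 := by
    rw [hg, hm, hw, exp_half_sq, exp_half_sq, exp_half_sq, ← Real.exp_add, ← Real.exp_sub]
    ring_nf
  rw [yFun, qRR_two_mul_self hε, qRR_half_add_sub, qRR_eq_exp_half, closedDenom, e,
    ← exp_half_sq (-ε), ← hm, ← hg, ← hw]
  field_simp
  ring

theorem zFun_eq (hε : 0 < ε) (m g w : ℝ) (hm : m = Real.exp (-ε / 2)) (hg : g = Real.exp (εg / 2))
    (hw : w = Real.exp (t / 2)) : zFun ε εg t =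
      m ^ 2 * ((1 - m ^ 2 * w ^ 2) * (1 - g / w) ^ 2) / closedDenom ε := by
  have hw0 : 0 < w := hw ▸ Real.exp_pos _
  have hm0 : 0 < m := hm ▸ Real.exp_pos _
  have hm1 : m < 1 := hm ▸ Real.exp_lt_one_iff.2 (by linarith)
  have h2 : 1 - m ^ 2 ≠ 0 := by nlinarith
  rw [zFun, qRR_two_mul_self hε, qRR_add_half_sub, qRR_eq_exp_half, closedDenom,
    ← exp_half_sq (-ε), ← hm, ← hg, ← hw]
  field_simp
  ring

/-- Passing from y to x replaces 1 - σ² by (1 - σm)²/(1 - m²) with σ = mg/w, a gain of m²(1 -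
g/w)²/(1 - m²). This is the square in z, and the weights agree because m² κ = 1 - κ for κ = `qRR (2
* ε) ε`. -/
theorem yFun_add_zFun_eq_xFun (hε : 0 < ε) : yFun ε εg t + zFun ε εg t = xFun ε εg t := by
  have hw0 := Real.exp_pos (t / 2)
  rw [xFun_eq εg t hε _ _ _ rfl rfl rfl, yFun_eq εg t hε _ _ _ rfl rfl rfl,
    zFun_eq εg t hε _ _ _ rfl rfl rfl, ← add_div]
  congr 1
  field_simp
  ring

end ClosedForms

/-! ### Maximizing x, y and z. -/

/-- The parameter enters only through -(1/w + mw), which AM-GM maximizes at w² = 1/m, that is, t =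
ε/2. -/
theorem xFun_le_xFun_half {ε : ℝ} (hε : 0 < ε) (εg t : ℝ) : xFun ε εg t ≤ xFun ε εg (ε / 2) := by
  have hw := Real.exp_pos (t / 2)
  have hv := Real.exp_pos (ε / 2 / 2)
  have hg := Real.exp_pos (εg / 2)
  have hm : Real.exp (-ε / 2) = 1 / Real.exp (ε / 2 / 2) ^ 2 := by
    rw [exp_half_sq, one_div, ← Real.exp_neg]; ring_nf
  have hm0 := Real.exp_pos (-ε / 2)
  have hm1 : Real.exp (-ε / 2) < 1 := Real.exp_lt_one_iff.2 (by linarith)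
  rw [xFun_eq εg t hε _ _ _ rfl rfl rfl, xFun_eq εg _ hε _ _ _ rfl rfl rfl]
  have key : 1 / Real.exp (ε / 2 / 2) + Real.exp (-ε / 2) * Real.exp (ε / 2 / 2) ≤
      1 / Real.exp (t / 2) + Real.exp (-ε / 2) * Real.exp (t / 2) := by
    rw [hm, ← sub_nonneg]
    have : 0 ≤ (Real.exp (t / 2) - Real.exp (ε / 2 / 2)) ^ 2 /
      (Real.exp (t / 2) * Real.exp (ε / 2 / 2) ^ 2) := by positivity
    refine this.trans_eq ?_
    field_simp
    ring
  have hc : 0 ≤ 2 * Real.exp (-ε / 2) ^ 2 * Real.exp (εg / 2) * (1 - Real.exp (-ε / 2)) :=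
    mul_nonneg (by positivity) (by linarith)
  exact div_le_div_of_nonneg_right (sub_le_sub_left (mul_le_mul_of_nonneg_left key hc) _)
    (closedDenom_pos hε).le

theorem xFun_le_xFun_of_le {ε εg t : ℝ} (hε : 0 < ε) (ht : t ≤ εg) (h : εg ≤ ε / 2) :
    xFun ε εg t ≤ xFun ε εg εg := by
  have hw := Real.exp_pos (t / 2)
  have hg := Real.exp_pos (εg / 2)
  have hm0 := Real.exp_pos (-ε / 2)
  have hm1 : Real.exp (-ε / 2) < 1 := Real.exp_lt_one_iff.2 (by linarith)
  have hwg : Real.exp (t / 2) ≤ Real.exp (εg / 2) := Real.exp_le_exp.2 (by linarith)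
  have hmgw : Real.exp (-ε / 2) * Real.exp (εg / 2) * Real.exp (t / 2) ≤ 1 := by
    rw [← Real.exp_add, ← Real.exp_add]
    exact Real.exp_le_one_iff.2 (by linarith)
  rw [xFun_eq εg t hε _ _ _ rfl rfl rfl, xFun_eq εg _ hε _ _ _ rfl rfl rfl]
  have key : 1 / Real.exp (εg / 2) + Real.exp (-ε / 2) * Real.exp (εg / 2) ≤
      1 / Real.exp (t / 2) + Real.exp (-ε / 2) * Real.exp (t / 2) := by
    rw [← sub_nonneg]
    have : 0 ≤ (Real.exp (εg / 2) - Real.exp (t / 2)) *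
        (1 - Real.exp (-ε / 2) * Real.exp (εg / 2) * Real.exp (t / 2)) /
        (Real.exp (t / 2) * Real.exp (εg / 2)) :=
      div_nonneg (mul_nonneg (by linarith) (by linarith)) (by positivity)
    refine this.trans_eq ?_
    field_simp
    ring
  have hc : 0 ≤ 2 * Real.exp (-ε / 2) ^ 2 * Real.exp (εg / 2) * (1 - Real.exp (-ε / 2)) :=
    mul_nonneg (by positivity) (by linarith)
  exact div_le_div_of_nonneg_right (sub_le_sub_left (mul_le_mul_of_nonneg_left key hc) _)
    (closedDenom_pos hε).le

theorem yFun_le_yFun_argmax {ε εg t : ℝ} (hεg : 0 ≤ εg) (hε : εg < ε) (h1 : t ≤ ε) :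
    yFun ε εg t ≤ yFun ε εg ((ε + εg) / 3) := by
  have hε0 : 0 < ε := by linarith
  obtain ⟨w, hw⟩ : ∃ w, w = Real.exp (t / 2) := ⟨_, rfl⟩
  obtain ⟨v, hv⟩ : ∃ v, v = Real.exp ((ε + εg) / 3 / 2) := ⟨_, rfl⟩
  obtain ⟨m, hm⟩ : ∃ m, m = Real.exp (-ε / 2) := ⟨_, rfl⟩
  have hw0 : 0 < w := hw ▸ Real.exp_pos _
  have hm0 : 0 < m := hm ▸ Real.exp_pos _
  have hv1 : 1 ≤ v := hv ▸ Real.one_le_exp (by linarith)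
  -- Eliminating g makes the critical point w = v a visible double root of the difference below.
  have hg : m * v ^ 3 = Real.exp (εg / 2) := by
    rw [hm, hv, ← Real.exp_nat_mul, ← Real.exp_add]; ring_nf
  have hwv : w ≤ v ^ 3 := by
    rw [hw, hv, ← Real.exp_nat_mul]
    exact Real.exp_le_exp.2 (by push_cast; linarith)
  rw [yFun_eq εg t hε0 m _ w hm hg hw, yFun_eq εg _ hε0 m _ v hm hg hv]
  refine div_le_div_of_nonneg_right ?_ (closedDenom_pos hε0).le
  -- The cofactor of (w - v)² is exactly the sum of the quantities in `h₁`, `h₃` and `h₄`.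
  have hquad : 0 ≤ v ^ 4 + 2 * v * (v ^ 2 - 1) * w - w ^ 2 := by
    have h₁ : 0 ≤ (v ^ 3 - w) * w := mul_nonneg (by linarith) hw0.le
    have h₂ : 0 ≤ v * (v ^ 2 - 1) := mul_nonneg (by linarith) (by nlinarith)
    have h₃ : 0 ≤ v * (v ^ 3 - w) := mul_nonneg (by linarith) (by linarith)
    have h₄ : 0 ≤ v * (v ^ 2 - 1) * w := mul_nonneg h₂ hw0.le
    nlinarith
  have key : 0 ≤ m ^ 4 * (w - v) ^ 2 * (v ^ 4 + 2 * v * (v ^ 2 - 1) * w - w ^ 2) / w ^ 2 :=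
    div_nonneg (mul_nonneg (by positivity) hquad) (by positivity)
  rw [← sub_nonneg]
  refine key.trans_eq ?_
  field_simp
  ring

theorem mul_sq_le_cube {a b c : ℝ} (ha : 0 ≤ a) (hb : 0 ≤ b) (h : a + 2 * b ≤ 3 * c) :
    a * b ^ 2 ≤ c ^ 3 := by
  have h₁ : a * b ^ 2 ≤ ((a + 2 * b) / 3) ^ 3 := by
    rw [← sub_nonneg]
    have : 0 ≤ (a - b) ^ 2 * (a + 8 * b) / 27 := by positivity
    refine this.trans_eq ?_
    ring
  exact h₁.trans (pow_le_pow_left₀ (by positivity) (by linarith) 3)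

theorem zFun_argmax_pos {ε εg : ℝ} (hεg : 0 ≤ εg) (hε : εg < ε) :
    0 < zFun ε εg ((2 * ε + εg) / 3) := by
  have hε0 : 0 < ε := by linarith
  rw [zFun_eq εg _ hε0 _ _ _ rfl rfl rfl]
  refine div_pos (mul_pos (pow_pos (Real.exp_pos _) 2) (mul_pos ?_ (pow_pos ?_ 2)))
    (closedDenom_pos hε0)
  · rw [exp_half_sq, exp_half_sq, ← Real.exp_add]
    exact sub_pos.2 (Real.exp_lt_one_iff.2 (by linarith))
  · rw [← Real.exp_sub]
    exact sub_pos.2 (Real.exp_lt_one_iff.2 (by linarith))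

/-- AM-GM twice. The factors 1 - m²w², 1 - g/w, 1 - g/w have product at most the cube of their mean
`c`, and with g = m²v³ this mean is strictly largest at w = v, where all three factors coincide. -/
theorem zFun_lt_zFun_argmax {ε εg t : ℝ} (hεg : 0 ≤ εg) (hε : εg < ε) (ht : εg ≤ t)
    (h1 : t ≤ ε) (hne : t ≠ (2 * ε + εg) / 3) : zFun ε εg t < zFun ε εg ((2 * ε + εg) / 3) := by
  have hε0 : 0 < ε := by linarith
  obtain ⟨w, hw⟩ : ∃ w, w = Real.exp (t / 2) := ⟨_, rfl⟩
  obtain ⟨v, hv⟩ : ∃ v, v = Real.exp ((2 * ε + εg) / 3 / 2) := ⟨_, rfl⟩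
  obtain ⟨m, hm⟩ : ∃ m, m = Real.exp (-ε / 2) := ⟨_, rfl⟩
  have hw0 : 0 < w := hw ▸ Real.exp_pos _
  have hm0 : 0 < m := hm ▸ Real.exp_pos _
  have hv0 : 0 < v := hv ▸ Real.exp_pos _
  have hg : m ^ 2 * v ^ 3 = Real.exp (εg / 2) := by
    rw [hm, hv, exp_half_sq, ← Real.exp_nat_mul, ← Real.exp_add]; ring_nf
  have ha : 0 ≤ 1 - m ^ 2 * w ^ 2 := by
    rw [hm, hw, exp_half_sq, exp_half_sq, ← Real.exp_add]
    exact sub_nonneg.2 (Real.exp_le_one_iff.2 (by linarith))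
  have hb : 0 ≤ 1 - m ^ 2 * v ^ 3 / w := by
    rw [hg, hw, ← Real.exp_sub]
    exact sub_nonneg.2 (Real.exp_le_one_iff.2 (by linarith))
  have hwv : w ≠ v := by
    rw [hw, hv]
    intro h
    exact hne (by linarith [Real.exp_injective h])
  rw [zFun_eq εg t hε0 m _ w hm hg hw, zFun_eq εg _ hε0 m _ v hm hg hv]
  refine div_lt_div_of_pos_right (mul_lt_mul_of_pos_left ?_ (by positivity)) (closedDenom_pos hε0)
  obtain ⟨c, hc⟩ : ∃ c, c = (1 - m ^ 2 * w ^ 2 + 2 * (1 - m ^ 2 * v ^ 3 / w)) / 3 := ⟨_, rfl⟩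
  have hc0 : 0 ≤ c := by rw [hc]; positivity
  have hlt : c < 1 - m ^ 2 * v ^ 2 := by
    rw [hc, ← sub_pos]
    have hsq : 0 < (w - v) ^ 2 := by
      have := sub_ne_zero.2 hwv
      positivity
    have : 0 < m ^ 2 * ((w - v) ^ 2 * (w + 2 * v)) / (3 * w) := by positivity
    refine this.trans_eq ?_
    field_simp
    ring
  have hv3 : 1 - m ^ 2 * v ^ 3 / v = 1 - m ^ 2 * v ^ 2 := by field_simp
  rw [hv3]
  calc _ ≤ c ^ 3 := mul_sq_le_cube ha hb (by rw [hc]; linarith)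
    _ < (1 - m ^ 2 * v ^ 2) ^ 3 := pow_lt_pow_left₀ hlt hc0 (by norm_num)
    _ = _ := by ring

theorem zFun_le_zFun_argmax {ε εg t : ℝ} (hεg : 0 ≤ εg) (hε : εg < ε) (ht : εg ≤ t)
    (h1 : t ≤ ε) : zFun ε εg t ≤ zFun ε εg ((2 * ε + εg) / 3) := by
  by_cases h : t = (2 * ε + εg) / 3
  · rw [h]
  · exact (zFun_lt_zFun_argmax hεg hε ht h1 h).le

/-- The contribution of the second outcome of the first mechanism is maximal at
`(2 * ε + εg) / 3`. -/
theorem grrValue_brDelta_le_zFun {ε εg t : ℝ} (hεg : 0 ≤ εg) (hε : εg < ε) (h1 : t ≤ ε) :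
    (1 - qRR (2 * ε) ε) * grrValue ε t (brDelta ε) (εg + ε) ≤ zFun ε εg ((2 * ε + εg) / 3) := by
  rcases le_total t εg with h | h
  · rw [grrValue_brDelta_eq_zero hεg hε h, mul_zero]
    exact (zFun_argmax_pos hεg hε).le
  · rw [grrValue_brDelta_eq_zFun hεg hε h h1]
    exact zFun_le_zFun_argmax hεg hε h h1

theorem grrValue_brDelta_add_eq_xFun {ε εg t : ℝ} (hεg : 0 ≤ εg) (hε : εg < ε)
    (ht : t ∈ Set.Icc 0 ε) :
    qRR (2 * ε) ε * grrValue ε t (brDelta ε) (εg - ε) +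
      (1 - qRR (2 * ε) ε) * grrValue ε t (brDelta ε) (εg + ε) = xFun ε εg t := by
  rcases le_total t εg with h | h
  · rw [grrValue_brDelta_eq_zero hεg hε h, mul_zero, add_zero,
      grrValue_brDelta_eq_xFun hεg hε ht.1 h]
  · rw [grrValue_brDelta_eq_yFun hεg hε h ht.2, grrValue_brDelta_eq_zFun hεg hε h ht.2,
      yFun_add_zFun_eq_xFun _ _ (by linarith)]

/-! ### The optimal values of the two orders. -/

theorem deltaOpt_DP_BR_BR {X : Type v} (Nbr : X → X → Prop)
    (hsymm : ∀ x x', Nbr x x' → Nbr x' x) (hne : ∃ x x', Nbr x x' ∧ x ≠ x') {ε : ℝ} (hε : 0 < ε)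
    (εg : ℝ) {a b : ℝ} (ha : a ∈ Set.Icc 0 ε) (hb : b ∈ Set.Icc 0 ε)
    (hA : ∀ t ∈ Set.Icc 0 ε, qRR (2 * ε) ε * grrValue ε t (brDelta ε) (εg - ε) ≤
      qRR (2 * ε) ε * grrValue ε a (brDelta ε) (εg - ε))
    (hB : ∀ t ∈ Set.Icc 0 ε, (1 - qRR (2 * ε) ε) * grrValue ε t (brDelta ε) (εg + ε) ≤
      (1 - qRR (2 * ε) ε) * grrValue ε b (brDelta ε) (εg + ε)) :
    deltaOpt Nbr (adaptive₃ (classDP.{u, v} Nbr ε) (classBR Nbr ε) (classBR Nbr ε)) εg =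
      qRR (2 * ε) ε * grrValue ε a (brDelta ε) (εg - ε) +
        (1 - qRR (2 * ε) ε) * grrValue ε b (brDelta ε) (εg + ε) := by
  have h2 : 0 < 2 * ε := by linarith
  have hκ : 0 < qRR (2 * ε) ε := by rw [qRR_two_mul_self hε]; positivity
  have hκ' : 0 < 1 - qRR (2 * ε) ε := by
    rw [qRR_two_mul_self hε, sub_pos, div_lt_one (by positivity)]
    have := Real.exp_pos (-ε / 2)
    nlinarith
  have hadd : εg + 2 * ε - ε = εg + ε := by ring
  refine le_antisymm ?_ ?_
  · refine deltaOpt_adaptive₃_le hε h2 hε (classDP_subset_ratioClass hsymm ε)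
      (classBR_subset_ratioClass Nbr ε)
      (add_nonneg (mul_nonneg hκ.le (grrValue_nonneg hε ha (brDelta_nonneg hε) _))
        (mul_nonneg hκ'.le (grrValue_nonneg hε hb (brDelta_nonneg hε) _))) ?_
    intro t₁ ht₁
    rw [Set.mem_singleton_iff.1 ht₁]
    refine ⟨grrValue ε a (brDelta ε) (εg - ε), grrValue ε b (brDelta ε) (εg + ε),
      fun t ht => le_of_mul_le_mul_left (hA t ht) hκ, fun t ht => ?_, ?_⟩
    · rw [hadd]
      exact le_of_mul_le_mul_left (hB t ht) hκ'
    · exact le_rfl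
  · obtain ⟨x, x', hx, hxx⟩ := hne
    have := le_deltaOpt_adaptive₃.{u, v} (C₁ := classDP Nbr ε) (C₂ := classBR Nbr ε) εg
      (t₂ := fun c => if c then a else b) hε h2 hε
      (t₁ := ε) ⟨hε.le, by linarith⟩ (by rintro (_ | _) <;> simpa) hx hxx
      (grr_mem_classDP Nbr x hε)
      (by rintro (_ | _); exacts [grr_mem_classBR Nbr x hε hb, grr_mem_classBR Nbr x hε ha])
    simpa [hadd] using this

theorem deltaOpt_BR_DP_BR {X : Type v} (Nbr : X → X → Prop)
    (hsymm : ∀ x x', Nbr x x' → Nbr x' x) (hne : ∃ x x', Nbr x x' ∧ x ≠ x') {ε εg : ℝ}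
    (hεg : 0 ≤ εg) (hε : εg < ε) :
    deltaOpt Nbr (adaptive₃ (classBR.{u, v} Nbr ε) (classDP Nbr ε) (classBR Nbr ε)) εg =
      xFun ε εg (ε / 2) := by
  have hε0 : 0 < ε := by linarith
  have h2 : 0 < 2 * ε := by linarith
  have hhalf : ε / 2 ∈ Set.Icc 0 ε := ⟨by linarith, by linarith⟩
  have hκ := qRR_two_mul_self_mem_Icc hε0
  -- With t fixed, the two randomized responses commute: both orders give the same four final
  -- thresholds with the same weights.
  have hval : ∀ t ∈ Set.Icc 0 ε, qRR ε t * grrValue (2 * ε) ε (brDelta ε) (εg - t) +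
      (1 - qRR ε t) * grrValue (2 * ε) ε (brDelta ε) (εg + ε - t) = xFun ε εg t := fun t ht => by
    rw [← grrValue_brDelta_add_eq_xFun hεg hε ht]
    simp only [grrValue]
    rw [show εg - t - ε = εg - ε - t by ring, show εg - t + 2 * ε - ε = εg + ε - t by ring,
      show εg + ε - t - ε = εg - ε + ε - t by ring,
      show εg + ε - t + 2 * ε - ε = εg + ε + ε - t by ring]
    ring
  refine le_antisymm ?_ ?_
  · refine deltaOpt_adaptive₃_le hε0 hε0 h2 (classBR_subset_ratioClass Nbr ε)
      (classDP_subset_ratioClass hsymm ε) ?_ fun t ht => ?_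
    · rw [← grrValue_brDelta_add_eq_xFun hεg hε hhalf]
      have hn := fun s => grrValue_nonneg hε0 hhalf (brDelta_nonneg hε0) s
      exact add_nonneg (mul_nonneg hκ.1 (hn _)) (mul_nonneg (by linarith [hκ.2]) (hn _))
    · refine ⟨grrValue (2 * ε) ε (brDelta ε) (εg - t), grrValue (2 * ε) ε (brDelta ε) (εg + ε - t),
        ?_, ?_, ?_⟩
      · rintro _ rfl
        exact le_rfl
      · rintro _ rfl
        exact le_rfl
      · rw [hval t ht]
        exact xFun_le_xFun_half hε0 εg t
  · obtain ⟨x, x', hx, hxx⟩ := hne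
    rw [← hval _ hhalf]
    exact le_deltaOpt_adaptive₃.{u, v} (C₁ := classBR Nbr ε) (C₂ := classDP Nbr ε) εg
      (t₂ := fun _ => ε) hε0 hε0 h2 hhalf (fun _ => ⟨hε0.le, by linarith⟩) hx hxx
      (grr_mem_classBR Nbr x hε0 hhalf) (fun _ => grr_mem_classDP Nbr x hε0)

theorem mainTheorem3 {X : Type v} (Nbr : X → X → Prop)
    (hsymm : ∀ x x', Nbr x x' → Nbr x' x)
    (hne : ∃ x x', Nbr x x' ∧ x ≠ x')
    (ε εg : ℝ) (hεg : 0 ≤ εg) (hε : εg < ε) :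
    deltaOpt Nbr (adaptive₃ (classBR.{u, v} Nbr ε) (classDP Nbr ε) (classBR Nbr ε)) εg <
        deltaOpt Nbr (adaptive₃ (classDP.{u, v} Nbr ε) (classBR Nbr ε) (classBR Nbr ε)) εg ∧
      deltaOpt Nbr (adaptive₃ (classDP.{u, v} Nbr ε) (classBR Nbr ε) (classBR Nbr ε)) εg =
        (if ε / 2 ≤ εg then
          xFun ε εg (ε / 2) + zFun ε εg ((2 * ε + εg) / 3)
        else
          yFun ε εg ((ε + εg) / 3) + zFun ε εg ((2 * ε + εg) / 3)) ∧
      deltaOpt Nbr (adaptive₃ (classBR.{u, v} Nbr ε) (classDP Nbr ε) (classBR Nbr ε)) εg =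
        (if ε / 2 ≤ εg then
          max (xFun ε εg (ε / 2)) (yFun ε εg εg + zFun ε εg εg)
        else
          max (xFun ε εg εg) (yFun ε εg (ε / 2) + zFun ε εg (ε / 2))) := by
  have hε0 : 0 < ε := by linarith
  have hκ := qRR_two_mul_self_mem_Icc hε0
  have hz : (2 * ε + εg) / 3 ∈ Set.Icc 0 ε := ⟨by linarith, by linarith⟩
  have hhalf : ε / 2 ∈ Set.Icc 0 ε := ⟨by linarith, by linarith⟩
  have hzval := grrValue_brDelta_eq_zFun (t := (2 * ε + εg) / 3) hεg hε (by linarith) hz.2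
  have hB : ∀ t ∈ Set.Icc 0 ε, (1 - qRR (2 * ε) ε) * grrValue ε t (brDelta ε) (εg + ε) ≤
      (1 - qRR (2 * ε) ε) * grrValue ε ((2 * ε + εg) / 3) (brDelta ε) (εg + ε) := fun t ht => by
    rw [hzval]
    exact grrValue_brDelta_le_zFun hεg hε ht.2
  rw [deltaOpt_BR_DP_BR Nbr hsymm hne hεg hε, yFun_add_zFun_eq_xFun _ _ hε0,
    yFun_add_zFun_eq_xFun _ _ hε0]
  split_ifs with h
  · have hxval := grrValue_brDelta_eq_xFun hεg hε hhalf.1 h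
    have hA : ∀ t ∈ Set.Icc 0 ε, qRR (2 * ε) ε * grrValue ε t (brDelta ε) (εg - ε) ≤
        qRR (2 * ε) ε * grrValue ε (ε / 2) (brDelta ε) (εg - ε) := fun t ht => by
      rw [hxval]
      refine le_trans ?_ (xFun_le_xFun_half hε0 εg t)
      rw [← grrValue_brDelta_add_eq_xFun hεg hε ht]
      -- Here A ≤ A + B = x, and B vanishes at ε/2 ≤ εg, so the maximizer of x also maximizes A.
      exact le_add_of_nonneg_right
        (mul_nonneg (by linarith [hκ.2]) (grrValue_nonneg hε0 ht (brDelta_nonneg hε0) _))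
    rw [deltaOpt_DP_BR_BR Nbr hsymm hne hε0 εg hhalf hz hA hB, hxval, hzval]
    exact ⟨lt_add_of_pos_right _ (zFun_argmax_pos hεg hε), rfl,
      (max_eq_left (xFun_le_xFun_half hε0 εg εg)).symm⟩
  · rw [not_le] at h
    have hy : (ε + εg) / 3 ∈ Set.Icc 0 ε := ⟨by linarith, by linarith⟩
    have hyval := grrValue_brDelta_eq_yFun (t := (ε + εg) / 3) hεg hε (by linarith) hy.2
    have hA : ∀ t ∈ Set.Icc 0 ε, qRR (2 * ε) ε * grrValue ε t (brDelta ε) (εg - ε) ≤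
        qRR (2 * ε) ε * grrValue ε ((ε + εg) / 3) (brDelta ε) (εg - ε) := fun t ht => by
      rw [hyval]
      -- On [0, εg] the branch follows x, which is largest at the right end; there x and y agree, so
      -- y takes over.
      rcases le_total t εg with htg | htg
      · rw [grrValue_brDelta_eq_xFun hεg hε ht.1 htg]
        refine (xFun_le_xFun_of_le hε0 htg h.le).trans ?_
        rw [← grrValue_brDelta_eq_xFun hεg hε hεg le_rfl,
          grrValue_brDelta_eq_yFun hεg hε le_rfl hε.le]
        exact yFun_le_yFun_argmax hεg hε hε.le
      · rw [grrValue_brDelta_eq_yFun hεg hε htg ht.2]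
        exact yFun_le_yFun_argmax hεg hε ht.2
    rw [deltaOpt_DP_BR_BR Nbr hsymm hne hε0 εg hy hz hA hB, hyval, hzval]
    refine ⟨?_, rfl, (max_eq_right (xFun_le_xFun_half hε0 εg εg)).symm⟩
    rw [← yFun_add_zFun_eq_xFun _ _ hε0]
    exact add_lt_add_of_le_of_lt (yFun_le_yFun_argmax hεg hε hhalf.2)
      (zFun_lt_zFun_argmax hεg hε h.le hhalf.2 (by linarith))
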